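/- Let $(R,\mathfrak m)$ be a Noetherian local ring of prime characteristic $p>0$ and dimension $d$. For an ideal $J$ let $J^{[p^e]}$ be the ideal generated by the $p^e$-th powers of elements of $J$, and let $J^F=\{x\in R: x^{p^e}\in J^{[p^e]}\text{ for all } e\gg 0\}$ be its Frobenius closure. A parameter ideal is an ideal generated by a full system of parameters, i.e. by $d$ elements that generate an $\mathfrak m$-primary ideal, and $$\mathrm{Fte}(R)=\inf\{e\in\mathbb N : (\mathfrak q^F)^{[p^e]}=\mathfrak q^{[p^e]}\text{ for all parameter ideals }\mathfrak q\subset R\}\in\mathbb N\cup\{\infty\}.$$ Local cohomology $H^j_{\mathfrak m}(-)$ is computed by the Čech complex on a finite set of generators of $\mathfrak m$. The Frobenius endomorphism of $R$ induces the standard Frobenius action $F$ on $H^k_{\mathfrak m}(R)$, and $$\mathrm{HSL}(H^k_{\mathfrak m}(R))=\inf\{e\in\mathbb N : F^e(\xi)=0\text{ whenever }F^{e'}(\xi)=0\text{ for some }e'\}\in\mathbb N\cup\{\infty\}.$$ For an ideal $J$ the map $R/J\to R/J^{[p^e]}$, $x+J\mapsto x^{p^e}+J^{[p^e]}$, induces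 the relative Frobenius action $F_R^e:H^j_{\mathfrak m}(R/J)\to H^j_{\mathfrak m}(R/J^{[p^e]})$, and the relative Frobenius closure of zero is $$0^{F_R}_{H^j_{\mathfrak m}(R/J)}=\{\xi\in H^j_{\mathfrak m}(R/J): F_R^e(\xi)=0\text{ for some }e\in\mathbb N\}.$$ A sequence $x_1,\dots,x_d\in\mathfrak m$ is filter regular if, for each $i$, $x_i$ lies in no associated prime of $R/(x_1,\dots,x_{i-1})$ other than $\mathfrak m$. **Theorem.** Let $e_0\in\mathbb N$. Suppose that for every $e\ge e_0$, every filter regular system of parameters $x_1,\dots,x_d$ of $R$, with $\mathfrak q_i=(x_1,\dots,x_i)$ and $\mathfrak q_0=0$, and all integers $i\ge 0$, $j\ge 0$ with $i+j<d$, the map $$\alpha_e: H^j_{\mathfrak m}\big(R/\mathfrak q_{i}^{[p^e]}\big)\to H^j_{\mathfrak m}\big(R/\mathfrak q_{i+1}^{[p^e]}\big)$$ induced by the natural projection satisfies $$\alpha_e^{-1}\Big(0^{F_R}_{H^j_{\mathfrak m}(R/\mathfrak q_{i+1}^{[p^e]})}\Big)=0^{F_R}_{H^j_{\mathfrak m}(R/\mathfrak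 q_{i}^{[p^e]})}.$$ Then $$\mathrm{Fte}(R)\le e_0+\sum_{k=0}^d\binom dk\,\mathrm{HSL}(H^k_{\mathfrak m}(R)).$$ -/

import Mathlib

/-!
# Čech local cohomology, Frobenius maps on it, and Frobenius test exponents
-/

section CechComplex

variable {R : Type*} [CommRing R] {n : ℕ} (s : Fin n → R)

/-- The localization `M_{s_T}` of `M` at the product `s_T = ∏_{i ∈ T} s_i`. -/
abbrev CechTerm (M : Type*) [AddCommGroup M] [Module R M] (T : Finset (Fin n)) : Type _ :=
  LocalizedModule (Submonoid.powers (∏ i ∈ T, s i)) M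

/-- Čech cochains of degree `j`: the (finite) direct sum of all
`M_{s_{i_1} ⋯ s_{i_j}}` with `i_1 < ⋯ < i_j`. -/
abbrev CechCochain (M : Type*) [AddCommGroup M] [Module R M] (j : ℕ) : Type _ :=
  (T : {T : Finset (Fin n) // T.card = j}) → CechTerm s M T.1

/-- For `T ⊆ T'`, powers of `s_T` act invertibly on `M_{s_{T'}}`. -/
theorem cechTerm_isUnit (M : Type*) [AddCommGroup M] [Module R M] {T T' : Finset (Fin n)}
    (h : T ⊆ T') (a : Submonoid.powers (∏ i ∈ T, s i)) :
    IsUnit (algebraMap R (Module.End R (CechTerm s M T')) a) := by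
  obtain ⟨_, k, rfl⟩ := a
  have h0 : IsUnit (algebraMap R (Module.End R (CechTerm s M T')) (∏ i ∈ T', s i)) :=
    IsLocalizedModule.map_units (S := Submonoid.powers (∏ i ∈ T', s i))
      (LocalizedModule.mkLinearMap (Submonoid.powers (∏ i ∈ T', s i)) M)
      ⟨_, Submonoid.mem_powers _⟩
  have h1 : IsUnit (algebraMap R (Module.End R (CechTerm s M T')) (∏ i ∈ T' \ T, s i) *
      algebraMap R (Module.End R (CechTerm s M T')) (∏ i ∈ T, s i)) := by
    have e := congrArg (algebraMap R (Module.End R (CechTerm s M T')))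
      (Finset.prod_sdiff (f := s) h)
    rw [map_mul] at e
    exact e ▸ h0
  have h2 : Commute (algebraMap R (Module.End R (CechTerm s M T')) (∏ i ∈ T' \ T, s i))
      (algebraMap R (Module.End R (CechTerm s M T')) (∏ i ∈ T, s i)) :=
    Algebra.commutes _ _
  simpa using (h2.isUnit_mul_iff.mp h1).2.pow k

/-- The canonical localization map `M_{s_T} → M_{s_{T'}}` for `T ⊆ T'`. -/
noncomputable def cechRestrict (M : Type*) [AddCommGroup M] [Module R M]
    {T T' : Finset (Fin n)} (h : T ⊆ T') : CechTerm s M T →ₗ[R] CechTerm s M T' :=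
  LocalizedModule.lift _ (LocalizedModule.mkLinearMap _ M) (cechTerm_isUnit s M h)

/-- The face `T' \ {i}` of `T'`. -/
def cechFace {j : ℕ} (T' : {T : Finset (Fin n) // T.card = j + 1}) (i : T'.1) :
    {T : Finset (Fin n) // T.card = j} :=
  ⟨T'.1.erase i, by rw [Finset.card_erase_of_mem i.2, T'.2, Nat.add_sub_cancel]⟩

theorem cechFace_subset {j : ℕ} (T' : {T : Finset (Fin n) // T.card = j + 1}) (i : T'.1) :
    (cechFace T' i).1 ⊆ T'.1 :=
  Finset.erase_subset _ _

/-- The Čech differential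
`(d c)_{T'} = ∑_{i ∈ T'} (-1)^{#{k ∈ T' | k < i}} c_{T' \ {i}}`. -/
noncomputable def cechDiff (M : Type*) [AddCommGroup M] [Module R M] (j : ℕ) :
    CechCochain s M j →ₗ[R] CechCochain s M (j + 1) :=
  LinearMap.pi fun T' => ∑ i : T'.1,
    ((-1 : R) ^ (T'.1.filter (fun k => k < i.1)).card) •
      (cechRestrict s M (cechFace_subset T' i) ∘ₗ LinearMap.proj (cechFace T' i))

/-- Čech coboundaries of degree `j`. -/
noncomputable def cechBoundaries (M : Type*) [AddCommGroup M] [Module R M] :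
    (j : ℕ) → Submodule R (CechCochain s M j)
  | 0 => ⊥
  | j + 1 => LinearMap.range (cechDiff s M j)

/-- Čech cocycles of degree `j`. -/
noncomputable def cechCocycles (M : Type*) [AddCommGroup M] [Module R M] (j : ℕ) :
    Submodule R (CechCochain s M j) :=
  LinearMap.ker (cechDiff s M j)

/-- The `j`-th local cohomology module `H^j_I(M)` for `I = (s_1, …, s_n)`, as the cohomology of the
Čech complex of `M` on the generators `s_1, …, s_n`. -/
abbrev LocalCoh (M : Type*) [AddCommGroup M] [Module R M] (j : ℕ) : Type _ :=
  cechCocycles s M j ⧸ (cechBoundaries s M j).comap (cechCocycles s M j).subtype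

end CechComplex

section Functoriality

variable {R : Type*} [CommRing R] {n : ℕ} (s : Fin n → R)
  {M N : Type*} [AddCommGroup M] [Module R M] [AddCommGroup N] [Module R N]
  {σ : R →+* R}

/-- Let `σ` be a ring endomorphism that sends every `a` to a power of `a` (such as the identity or
an iterate of Frobenius). A `σ`-semilinear map `f : M → N` induces the `σ`-semilinear map
`M_{s_T} → N_{s_T}`, `m / a ↦ f m / σ a`. -/
noncomputable def cechTermMap (hσ : ∀ a, σ a ∈ Submonoid.powers a) (f : M →ₛₗ[σ] N)
    (T : Finset (Fin n)) : CechTerm s M T →ₛₗ[σ] CechTerm s N T :=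
  have hmem : ∀ a : Submonoid.powers (∏ i ∈ T, s i),
      σ a ∈ Submonoid.powers (∏ i ∈ T, s i) := fun a =>
    (Submonoid.powers_le.mpr a.2) (hσ a)
  { toFun := fun z => z.liftOn (fun ma => LocalizedModule.mk (f ma.1) ⟨σ ma.2, hmem ma.2⟩) (by
      rintro ⟨m, a⟩ ⟨m', a'⟩ h
      obtain ⟨u, hu⟩ := h
      refine LocalizedModule.mk_eq.mpr ⟨⟨σ u, hmem u⟩, ?_⟩
      have := congrArg f hu
      simpa [Submonoid.smul_def] using this)
    map_add' := by
      intro x y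
      induction x, y using LocalizedModule.induction_on₂ with
      | _ m m' a a' =>
        rw [LocalizedModule.mk_add_mk]
        simp only [LocalizedModule.liftOn_mk]
        rw [LocalizedModule.mk_add_mk]
        congr 1
        · simp [Submonoid.smul_def]
        · exact Subtype.ext (by simp)
    map_smul' := by
      intro r x
      induction x using LocalizedModule.induction_on with
      | _ m a =>
        rw [LocalizedModule.smul'_mk]
        simp only [LocalizedModule.liftOn_mk]
        rw [LocalizedModule.smul'_mk, map_smulₛₗ] }

theorem cechTermMap_restrict (hσ : ∀ a, σ a ∈ Submonoid.powers a) (f : M →ₛₗ[σ] N)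
    {T T' : Finset (Fin n)} (h : T ⊆ T') (z : CechTerm s M T) :
    cechTermMap s hσ f T' (cechRestrict s M h z) =
      cechRestrict s N h (cechTermMap s hσ f T z) := by
  induction z using LocalizedModule.induction_on with
  | _ m a =>
    have hmem : σ a ∈ Submonoid.powers (∏ i ∈ T, s i) :=
      (Submonoid.powers_le.mpr a.2) (hσ a)
    have hinj : Function.Injective
        (algebraMap R (Module.End R (CechTerm s N T')) (σ a)) :=
      ((Module.End.isUnit_iff _).mp (cechTerm_isUnit s N h ⟨σ a, hmem⟩)).1
    apply hinj
    have e1 : (a : R) • LocalizedModule.mk m a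
        = LocalizedModule.mkLinearMap (Submonoid.powers (∏ i ∈ T, s i)) M m := by
      rw [LocalizedModule.smul'_mk]; exact LocalizedModule.mk_cancel a m
    have e2 : (σ a) • cechTermMap s hσ f T (LocalizedModule.mk m a)
        = LocalizedModule.mkLinearMap (Submonoid.powers (∏ i ∈ T, s i)) N (f m) := by
      change (σ a) • LocalizedModule.mk (f m) (⟨σ a, hmem⟩ : Submonoid.powers (∏ i ∈ T, s i)) = _
      rw [LocalizedModule.smul'_mk]
      exact LocalizedModule.mk_cancel (⟨σ a, hmem⟩ : Submonoid.powers (∏ i ∈ T, s i)) (f m)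
    simp only [Module.algebraMap_end_apply]
    rw [← map_smulₛₗ, ← map_smul, ← map_smul, e1, e2]
    simp only [cechRestrict, LocalizedModule.mkLinearMap_apply, LocalizedModule.lift_mk_one]
    change LocalizedModule.mk (f m) _ = LocalizedModule.mk (f m) _
    congr 1
    exact Subtype.ext (by simp)

/-- The map induced on Čech cochains. -/
noncomputable def cechCochainMap (hσ : ∀ a, σ a ∈ Submonoid.powers a) (f : M →ₛₗ[σ] N) (j : ℕ) :
    CechCochain s M j →ₛₗ[σ] CechCochain s N j where
  toFun c T := cechTermMap s hσ f T.1 (c T)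
  map_add' c c' := by ext T; simp
  map_smul' r c := by ext T; simp

theorem cechCochainMap_diff (hσ : ∀ a, σ a ∈ Submonoid.powers a) (f : M →ₛₗ[σ] N) (j : ℕ)
    (c : CechCochain s M j) :
    cechCochainMap s hσ f (j + 1) (cechDiff s M j c) =
      cechDiff s N j (cechCochainMap s hσ f j c) := by
  ext T'
  simp [cechCochainMap, cechDiff, cechTermMap_restrict]

/-- The map `H^j_I(M) → H^j_I(N)` induced by `f`. It is linear if `f` is, and `p^e`-linear if
`f` is. -/
noncomputable def localCohMap (hσ : ∀ a, σ a ∈ Submonoid.powers a) (f : M →ₛₗ[σ] N) (j : ℕ) :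
    LocalCoh s M j →ₛₗ[σ] LocalCoh s N j :=
  Submodule.mapQ _ _
    ((cechCochainMap s hσ f j).restrict (p := cechCocycles s M j) (q := cechCocycles s N j)
      (by
        intro c hc
        rw [cechCocycles, LinearMap.mem_ker] at hc ⊢
        rw [← cechCochainMap_diff, hc, map_zero]))
    (by
      rintro ⟨c, hc⟩ hb
      cases j with
      | zero =>
        simp only [Submodule.mem_comap, cechBoundaries, Submodule.mem_bot,
          Submodule.subtype_apply] at hb ⊢
        simp [hb]
      | succ j =>
        obtain ⟨b, hb⟩ := hb
        exact ⟨cechCochainMap s hσ f j b, by rw [← cechCochainMap_diff, hb]; rfl⟩)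

end Functoriality

section Frobenius

variable {R : Type*} [CommRing R] (p : ℕ) [ExpChar R p]

/-- The bracket power `J^{[p^e]}`, generated by the `p^e`-th powers of the elements of `J`. -/
def bracketPow (J : Ideal R) (e : ℕ) : Ideal R :=
  J.map (iterateFrobenius R p e)

/-- The Frobenius closure `I^F = {x | x^{p^e} ∈ I^{[p^e]} for all e ≫ 0}`. -/
def frobeniusClosure (I : Ideal R) : Ideal R where
  carrier := {x | ∀ᶠ e in Filter.atTop, x ^ p ^ e ∈ bracketPow p I e}
  zero_mem' := Filter.Eventually.of_forall fun e => by
    have h := (bracketPow p I e).zero_mem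
    rwa [← map_zero (iterateFrobenius R p e), iterateFrobenius_def] at h
  add_mem' := by
    intro x y hx hy
    filter_upwards [hx, hy] with e h1 h2
    rw [add_pow_expChar_pow]
    exact Ideal.add_mem _ h1 h2
  smul_mem' := by
    intro r x hx
    filter_upwards [hx] with e h
    rw [smul_eq_mul, mul_pow]
    exact Ideal.mul_mem_left _ _ h

theorem iterateFrobenius_mem_powers (e : ℕ) (a : R) :
    iterateFrobenius R p e a ∈ Submonoid.powers a :=
  ⟨p ^ e, (iterateFrobenius_def p e a).symm⟩

/-- The relative Frobenius map `F_R^e : R/J → R/J^{[p^e]}`, `x + J ↦ x^{p^e} + J^{[p^e]}`. -/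
def relFrobenius (J : Ideal R) (e : ℕ) :
    (R ⧸ J) →ₛₗ[iterateFrobenius R p e] (R ⧸ bracketPow p J e) :=
  Submodule.mapQ J (bracketPow p J e) (LinearMap.iterateFrobenius R R p e)
    (fun _ hx => Ideal.mem_map_of_mem (iterateFrobenius R p e) hx)

variable {n : ℕ} (s : Fin n → R)

/-- The relative Frobenius action `F_R^e : H^j_I(R/J) → H^j_I(R/J^{[p^e]})`. -/
noncomputable def relFrobeniusCoh (J : Ideal R) (e j : ℕ) :
    LocalCoh s (R ⧸ J) j →ₛₗ[iterateFrobenius R p e] LocalCoh s (R ⧸ bracketPow p J e) j :=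
  localCohMap s (iterateFrobenius_mem_powers p e) (relFrobenius p J e) j

/-- The relative Frobenius closure of zero in `H^j_I(R/J)`. -/
def relFrobeniusClosureZero (J : Ideal R) (j : ℕ) : Set (LocalCoh s (R ⧸ J) j) :=
  {ξ | ∃ e : ℕ, relFrobeniusCoh p s J e j ξ = 0}

/-- The standard Frobenius action on `H^j_I(R)`. -/
noncomputable def frobeniusCoh (j : ℕ) :
    LocalCoh s R j →ₛₗ[frobenius R p] LocalCoh s R j :=
  localCohMap s (fun a => ⟨p, (frobenius_def p a).symm⟩) (LinearMap.frobenius R R p) j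

/-- The Hartshorne–Speiser–Lyubeznik number of a module with a Frobenius action `F`: the least `e`
such that `F^e` vanishes on `0^F = {m | F^{e'} m = 0 for some e'}` (and `∞` if there is none). -/
noncomputable def hslNumber {M : Type*} [AddCommGroup M] [Module R M]
    (F : M →ₛₗ[frobenius R p] M) : ℕ∞ :=
  ⨅ (e : ℕ) (_ : ∀ m : M, (∃ e' : ℕ, F^[e'] m = 0) → F^[e] m = 0), (e : ℕ∞)

/-- The map `H^j_I(R/J) → H^j_I(R/K)` induced by the projection `R/J → R/K`, for `J ⊆ K`. -/
noncomputable def quotientCohMap {J K : Ideal R} (h : J ≤ K) (j : ℕ) :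
    LocalCoh s (R ⧸ J) j →ₗ[R] LocalCoh s (R ⧸ K) j :=
  localCohMap s (fun a => Submonoid.mem_powers a) (Submodule.mapQ J K LinearMap.id h) j

end Frobenius

section Parameters

variable {R : Type*} [CommRing R]

/-- The ideal `(x_1, …, x_i)` generated by the first `i` terms of a sequence. -/
def initialIdeal {d : ℕ} (x : Fin d → R) (i : ℕ) : Ideal R :=
  Ideal.span (x '' {k | (k : ℕ) < i})

theorem initialIdeal_mono {d : ℕ} (x : Fin d → R) {i i' : ℕ} (h : i ≤ i') :
    initialIdeal x i ≤ initialIdeal x i' :=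
  Ideal.span_mono (Set.image_mono fun _ hk => lt_of_lt_of_le hk h)

theorem bracketPow_initialIdeal_le_succ (p : ℕ) [ExpChar R p] {d : ℕ} (x : Fin d → R) (i e : ℕ) :
    bracketPow p (initialIdeal x i) e ≤ bracketPow p (initialIdeal x (i + 1)) e :=
  Ideal.map_mono (initialIdeal_mono x (Nat.le_succ i))

variable [IsLocalRing R]

/-- A (full) system of parameters: `d = dim R` elements generating an `𝔪`-primary ideal. -/
def IsSystemOfParameters {d : ℕ} (x : Fin d → R) : Prop :=
  ringKrullDim R = d ∧ (Ideal.span (Set.range x)).radical = IsLocalRing.maximalIdeal R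

/-- A parameter ideal: an ideal generated by a full system of parameters. -/
def IsParameterIdeal (q : Ideal R) : Prop :=
  ∃ (d : ℕ) (x : Fin d → R), IsSystemOfParameters x ∧ q = Ideal.span (Set.range x)

/-- A filter regular sequence: each `x_i` lies in `𝔪` and in no associated prime of
`R/(x_1, …, x_{i-1})` other than `𝔪`. -/
def IsFilterRegular {d : ℕ} (x : Fin d → R) : Prop :=
  ∀ i : Fin d, x i ∈ IsLocalRing.maximalIdeal R ∧
    ∀ P ∈ associatedPrimes R (R ⧸ initialIdeal x i), P ≠ IsLocalRing.maximalIdeal R → x i ∉ P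

/-- The Frobenius test exponent for parameter ideals: the least `e` with
`(q^F)^{[p^e]} = q^{[p^e]}` for all parameter ideals `q` (and `∞` if there is none). -/
noncomputable def frobeniusTestExponent (R : Type*) [CommRing R] [IsLocalRing R] (p : ℕ)
    [ExpChar R p] : ℕ∞ :=
  ⨅ (e : ℕ) (_ : ∀ q : Ideal R, IsParameterIdeal q →
    bracketPow p (frobeniusClosure p q) e = bracketPow p q e), (e : ℕ∞)

end Parameters

/-! By prime avoidance every parameter ideal `q` is generated by a filter regular system of
parameters. Modulo the `𝔪`-primary ideal `q^{[p^e₀]}`, `H^0` is the whole quotient, and a relative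
Frobenius nilpotent in it is an element of the Frobenius closure of `q^{[p^e₀]}`. So it suffices to
find one `E` with `F_R^E` killing all these nilpotents; the test exponent is then at most `e₀ + E`.

More generally, let `E_{i,j}` be an exponent killing the nilpotents of `H^j(R/q_i^{[p^e]})` for all
`e ≥ e₀` at once. For `i = 0` the HSL number of `H^j(R)` serves. For the passage from `J =
q_i^{[p^e]}` to `(J, y)`, where `y` is the `p^e`-th power of the next parameter, there is a
connecting map `H^j(R/(J, y)) → H^{j+1}(R/J)`, because `y` is a nonzerodivisor modulo `J` up to
`𝔪`-torsion. It commutes with Frobenius if `y` is replaced by `y^{p^a}` on the target. A nilpotent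
`ξ` therefore has a nilpotent image, killed by `F_R^a` with `a = E_{i,j+1}`. By exactness `F_R^a ξ`
lifts to some `ζ` in `H^j(R/J^{[p^a]})`, which is nilpotent by the hypothesis on `α`, and is killed
by `F_R^b` with `b = E_{i,j}`. Thus `E_{i+1,j} = E_{i,j+1} + E_{i,j}`, Pascal's recursion, and
`E_{d,0}` is the binomial sum.

The induction step is `relFrobeniusCoh_eq_zero_of_sup`; `IsRegularSeqAway.pow` supplies regularity
of the powers of the parameters, and `pow_mem_bracketPow_of_relFrobeniusCoh_eq_zero` translates back
to ideals. -/

/-! ### The Čech differential squares to zero -/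

section CechComplex

variable {R : Type*} [CommRing R] {n : ℕ} (s : Fin n → R) (M : Type*) [AddCommGroup M] [Module R M]

theorem cechRestrict_comp {T T' T'' : Finset (Fin n)} (h : T ⊆ T') (h' : T' ⊆ T'')
    (z : CechTerm s M T) :
    cechRestrict s M h' (cechRestrict s M h z) = cechRestrict s M (h.trans h') z := by
  have e : cechRestrict s M h' ∘ₗ cechRestrict s M h = cechRestrict s M (h.trans h') := by
    refine IsLocalizedModule.ext (Submonoid.powers (∏ i ∈ T, s i))
      (LocalizedModule.mkLinearMap _ M) (cechTerm_isUnit s M (h.trans h')) ?_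
    ext m
    simp [cechRestrict, LocalizedModule.lift_mk_one]
  exact LinearMap.congr_fun e z

theorem cechRestrict_congr {j : ℕ} (c : CechCochain s M j)
    {T₁ T₂ : {T : Finset (Fin n) // T.card = j}} (e : T₁ = T₂) {T' : Finset (Fin n)}
    (h₁ : T₁.1 ⊆ T') (h₂ : T₂.1 ⊆ T') :
    cechRestrict s M h₁ (c T₁) = cechRestrict s M h₂ (c T₂) := by
  subst e; rfl

/-- For `i < k`, deleting `i` lowers the position of `k` by one, whereas deleting `k` leaves the
position of `i` unchanged; so the two orders of deletion carry opposite signs. -/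
theorem cechSign_swap {T : Finset (Fin n)} {i k : Fin n} (hi : i ∈ T) (hk : k ∈ T) (hik : i ≠ k) :
    (-1 : R) ^ (T.filter (· < i)).card * (-1) ^ ((T.erase i).filter (· < k)).card +
      (-1) ^ (T.filter (· < k)).card * (-1) ^ ((T.erase k).filter (· < i)).card = 0 := by
  wlog h : i < k generalizing i k
  · rw [add_comm]
    exact this hk hi hik.symm (lt_of_le_of_ne (not_lt.mp h) hik.symm)
  have e1 : (T.erase k).filter (· < i) = T.filter (· < i) := by
    ext l; simp only [Finset.mem_filter, Finset.mem_erase]; grind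
  have e2 : (T.erase i).filter (· < k) = (T.filter (· < k)).erase i := by
    ext l; simp only [Finset.mem_filter, Finset.mem_erase]; grind
  have e3 : ((T.filter (· < k)).erase i).card + 1 = (T.filter (· < k)).card :=
    Finset.card_erase_add_one (by simp [hi, h])
  rw [e1, e2, ← e3, pow_succ]
  ring

theorem cechDiff_comp (j : ℕ) (c : CechCochain s M j) :
    cechDiff s M (j + 1) (cechDiff s M j c) = 0 := by
  ext T
  simp only [cechDiff, LinearMap.pi_apply, LinearMap.sum_apply, LinearMap.smul_apply,
    LinearMap.comp_apply, LinearMap.proj_apply, map_sum, map_smul, cechRestrict_comp,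
    Finset.smul_sum, smul_smul, Pi.zero_apply]
  rw [Finset.sum_sigma']
  have mem2 : ∀ x : (i : T.1) × (cechFace T i).1, x.2.1 ∈ T.1 := fun x =>
    Finset.mem_of_mem_erase x.2.2
  have ne2 : ∀ x : (i : T.1) × (cechFace T i).1, x.2.1 ≠ x.1.1 := fun x =>
    Finset.ne_of_mem_erase x.2.2
  -- The involution exchanges the order in which two indices are deleted; it has no fixed point
  -- because the indices differ.
  refine Finset.sum_involution
    (fun x _ => ⟨⟨x.2.1, mem2 x⟩, ⟨x.1.1, Finset.mem_erase.mpr ⟨(ne2 x).symm, x.1.2⟩⟩⟩)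
    ?_ ?_ (fun _ _ => by simp) ?_
  · rintro ⟨⟨i, hi⟩, ⟨k, hk⟩⟩ _
    have hk' := Finset.mem_erase.mp hk
    rw [cechRestrict_congr s M c (T₁ := cechFace (cechFace T ⟨i, hi⟩) ⟨k, hk⟩)
      (T₂ := cechFace (cechFace T ⟨k, hk'.2⟩) ⟨i, Finset.mem_erase.mpr ⟨hk'.1.symm, hi⟩⟩)
      (Subtype.ext Finset.erase_right_comm) _
      ((cechFace_subset _ _).trans (cechFace_subset _ _)), ← add_smul]
    exact (congrArg (· • _) (cechSign_swap hi hk'.2 hk'.1.symm)).trans (zero_smul _ _)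
  · rintro ⟨⟨i, hi⟩, ⟨k, hk⟩⟩ _ _ h
    exact (Finset.mem_erase.mp hk).1 (congrArg (fun x => x.1.1) h)
  · rintro ⟨⟨i, hi⟩, ⟨k, hk⟩⟩ _
    rfl

end CechComplex
-- Composition of induced maps on cohomology
section Functoriality

variable {R : Type*} [CommRing R] {n : ℕ} (s : Fin n → R)
  {M N P : Type*} [AddCommGroup M] [Module R M] [AddCommGroup N] [Module R N]
  [AddCommGroup P] [Module R P] {σ τ ρ : R →+* R}

@[simp]
theorem cechTermMap_mk (hσ : ∀ a, σ a ∈ Submonoid.powers a) (f : M →ₛₗ[σ] N)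
    (T : Finset (Fin n)) (m : M) (a : Submonoid.powers (∏ i ∈ T, s i)) :
    cechTermMap s hσ f T (LocalizedModule.mk m a) =
      LocalizedModule.mk (f m) ⟨σ a, (Submonoid.powers_le.mpr a.2) (hσ a)⟩ :=
  rfl

@[simp]
theorem cechCochainMap_apply (hσ : ∀ a, σ a ∈ Submonoid.powers a) (f : M →ₛₗ[σ] N) (j : ℕ)
    (c : CechCochain s M j) (T) :
    cechCochainMap s hσ f j c T = cechTermMap s hσ f T.1 (c T) :=
  rfl

/-- The composite is a separate map `h` over `ρ`, tied to `f` and `g` by pointwise equations, so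
that the same lemma covers linear maps, iterates of Frobenius and mixtures of both. -/
theorem cechCochainMap_comp (hσ : ∀ a, σ a ∈ Submonoid.powers a) (hτ : ∀ a, τ a ∈ Submonoid.powers a)
    (hρ : ∀ a, ρ a ∈ Submonoid.powers a) (hc : ∀ a, τ (σ a) = ρ a)
    (f : M →ₛₗ[σ] N) (g : N →ₛₗ[τ] P) (h : M →ₛₗ[ρ] P) (hfg : ∀ m, g (f m) = h m) (j : ℕ)
    (c : CechCochain s M j) :
    cechCochainMap s hτ g j (cechCochainMap s hσ f j c) = cechCochainMap s hρ h j c := by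
  ext T
  simp only [cechCochainMap_apply]
  induction c T using LocalizedModule.induction_on with
  | _ m a =>
    simp only [cechTermMap_mk, hfg]
    congr 1
    exact Subtype.ext (hc a)

variable (M) in
/-- The class of a Čech cocycle. -/
noncomputable def cechClass {j : ℕ} (c : CechCochain s M j) (hc : cechDiff s M j c = 0) : LocalCoh s M j :=
  Submodule.Quotient.mk ⟨c, hc⟩

theorem cechClass_surjective {j : ℕ} (ξ : LocalCoh s M j) : ∃ c hc, cechClass s M c hc = ξ := by
  obtain ⟨⟨c, hc⟩, rfl⟩ := Submodule.Quotient.mk_surjective _ ξ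
  exact ⟨c, hc, rfl⟩

theorem cechClass_eq_zero {j : ℕ} {c : CechCochain s M j} {hc : cechDiff s M j c = 0} :
    cechClass s M c hc = 0 ↔ c ∈ cechBoundaries s M j :=
  Submodule.Quotient.mk_eq_zero _

theorem cechCochainMap_diff_eq_zero (hσ : ∀ a, σ a ∈ Submonoid.powers a) (f : M →ₛₗ[σ] N) {j : ℕ}
    {c : CechCochain s M j} (hc : cechDiff s M j c = 0) :
    cechDiff s N j (cechCochainMap s hσ f j c) = 0 := by
  rw [← cechCochainMap_diff, hc, map_zero]

theorem localCohMap_cechClass (hσ : ∀ a, σ a ∈ Submonoid.powers a) (f : M →ₛₗ[σ] N) {j : ℕ}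
    (c : CechCochain s M j) (hc : cechDiff s M j c = 0) :
    localCohMap s hσ f j (cechClass s M c hc) =
      cechClass s N (cechCochainMap s hσ f j c) (cechCochainMap_diff_eq_zero s hσ f hc) :=
  rfl

theorem localCohMap_comp (hσ : ∀ a, σ a ∈ Submonoid.powers a) (hτ : ∀ a, τ a ∈ Submonoid.powers a)
    (hρ : ∀ a, ρ a ∈ Submonoid.powers a) (hc : ∀ a, τ (σ a) = ρ a)
    (f : M →ₛₗ[σ] N) (g : N →ₛₗ[τ] P) (h : M →ₛₗ[ρ] P) (hfg : ∀ m, g (f m) = h m) (j : ℕ)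
    (ξ : LocalCoh s M j) :
    localCohMap s hτ g j (localCohMap s hσ f j ξ) = localCohMap s hρ h j ξ := by
  obtain ⟨c, hc, rfl⟩ := cechClass_surjective s ξ
  simp only [localCohMap_cechClass]
  congr 1
  exact cechCochainMap_comp s hσ hτ hρ ‹_› f g h hfg j c

theorem localCohMap_id (hσ : ∀ a, σ a ∈ Submonoid.powers a) (hσ1 : ∀ a, σ a = a) (f : M →ₛₗ[σ] M)
    (hf : ∀ m, f m = m) (j : ℕ) (ξ : LocalCoh s M j) : localCohMap s hσ f j ξ = ξ := by
  obtain ⟨c, hc, rfl⟩ := cechClass_surjective s ξ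
  simp only [localCohMap_cechClass]
  congr 1
  ext T
  simp only [cechCochainMap_apply]
  induction c T using LocalizedModule.induction_on with
  | _ m a =>
    simp only [cechTermMap_mk, hf]
    congr 1
    exact Subtype.ext (hσ1 a)

end Functoriality

/-! ### Exactness of Čech cochains -/

section Exactness

variable {R : Type*} [CommRing R] {n : ℕ} (s : Fin n → R)
  {M N : Type*} [AddCommGroup M] [Module R M] [AddCommGroup N] [Module R N]

theorem cechCochainMap_surjective (hσ : ∀ a, RingHom.id R a ∈ Submonoid.powers a) (f : M →ₗ[R] N)
    (hf : Function.Surjective f) (j : ℕ) (c : CechCochain s N j) :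
    ∃ b, cechCochainMap s hσ f j b = c := by
  have h : ∀ T, ∃ z, cechTermMap s hσ f T.1 z = c T := by
    intro T
    induction c T using LocalizedModule.induction_on with
    | _ m a =>
      obtain ⟨m, rfl⟩ := hf m
      exact ⟨LocalizedModule.mk m a, rfl⟩
  choose b hb using h
  exact ⟨b, funext hb⟩

/-- Localization is exact: the kernel of the map on cochains induced by a map with kernel `x M` is
`x` times the cochains. -/
theorem exists_smul_eq_of_cechCochainMap_eq_zero (hσ : ∀ a, RingHom.id R a ∈ Submonoid.powers a)
    (f : M →ₗ[R] N) {x : R} (hf : ∀ m, f m = 0 → ∃ m', m = x • m') (j : ℕ) (c : CechCochain s M j)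
    (hc : cechCochainMap s hσ f j c = 0) : ∃ b, c = x • b := by
  have h : ∀ T, ∃ z, c T = x • z := by
    intro T
    have hT : cechTermMap s hσ f T.1 (c T) = 0 := congrFun hc T
    generalize c T = z at hT
    induction z using LocalizedModule.induction_on with
    | _ m a =>
      rw [cechTermMap_mk, ← LocalizedModule.zero_mk 1, LocalizedModule.mk_eq] at hT
      obtain ⟨u, hu⟩ := hT
      simp only [one_smul, smul_zero] at hu
      obtain ⟨m', hm'⟩ := hf (u • m) (by rw [Submonoid.smul_def, map_smul]; exact hu)
      refine ⟨LocalizedModule.mk m' (u * a), ?_⟩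
      rw [LocalizedModule.smul'_mk, ← hm', LocalizedModule.mk_cancel_common_left]
  choose b hb using h
  exact ⟨b, funext hb⟩

/-- If `x` is a nonzerodivisor on `M` up to `s_k`-torsion for each `k`, then it acts injectively on
Čech cochains of positive degree. -/
theorem cechCochain_smul_injective {x : R}
    (hx : ∀ k, ∀ m : M, x • m = 0 → ∃ N : ℕ, s k ^ N • m = 0) (j : ℕ)
    (c : CechCochain s M (j + 1)) (hc : x • c = 0) : c = 0 := by
  ext T
  have hT : x • c T = 0 := congrFun hc T
  rw [Pi.zero_apply]
  obtain ⟨k, hk⟩ : T.1.Nonempty := Finset.card_pos.mp (by rw [T.2]; omega)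
  generalize c T = z at hT
  induction z using LocalizedModule.induction_on with
  | _ m a =>
    rw [LocalizedModule.smul'_mk, ← LocalizedModule.zero_mk 1, LocalizedModule.mk_eq] at hT
    obtain ⟨u, hu⟩ := hT
    simp only [one_smul, smul_zero] at hu
    obtain ⟨N, hN⟩ := hx k (u • m) (by rw [smul_comm]; exact hu)
    rw [← LocalizedModule.zero_mk 1, LocalizedModule.mk_eq]
    refine ⟨⟨(∏ i ∈ T.1, s i) ^ N, pow_mem (Submonoid.mem_powers _) N⟩ * u, ?_⟩
    simp only [one_smul, smul_zero, mul_smul]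
    change (∏ i ∈ T.1, s i) ^ N • u • m = 0
    rw [show (∏ i ∈ T.1, s i) ^ N = (∏ i ∈ T.1.erase k, s i) ^ N * s k ^ N by
      rw [← mul_pow, Finset.prod_erase_mul _ _ hk], mul_smul, hN, smul_zero]

end Exactness

/-! ### The connecting homomorphism as a relation -/

section Connecting

variable {R : Type*} [CommRing R] {n : ℕ} (s : Fin n → R)
  {M N : Type*} [AddCommGroup M] [Module R M] [AddCommGroup N] [Module R N]

/-- The graph of the connecting homomorphism `H^j(N) → H^{j+1}(M)` of `0 → M → M → N → 0`, where the
first map is multiplication by `x` and the second is `f`. Here `x` need only be a nonzerodivisor on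
`M` after inverting any of the `s_k`. -/
def IsConnecting (hσ : ∀ a, RingHom.id R a ∈ Submonoid.powers a) (f : M →ₗ[R] N) (x : R) {j : ℕ}
    (ξ : LocalCoh s N j) (η : LocalCoh s M (j + 1)) : Prop :=
  ∃ (b : CechCochain s M j) (w : CechCochain s M (j + 1))
    (hb : cechDiff s N j (cechCochainMap s hσ f j b) = 0) (hw : cechDiff s M (j + 1) w = 0),
    cechDiff s M j b = x • w ∧ cechClass s N _ hb = ξ ∧ cechClass s M w hw = η

variable {s} {hσ : ∀ a, RingHom.id R a ∈ Submonoid.powers a} {f : M →ₗ[R] N} {x : R} {j : ℕ}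

/-- The usual diagram chase: lift a cocycle to `b` and divide its differential by `x`. The quotient
`w` is a cocycle since `x` is injective on cochains of positive degree. -/
theorem exists_isConnecting (hσ : ∀ a, RingHom.id R a ∈ Submonoid.powers a)
    (hf : Function.Surjective f) (hfx : ∀ m, f m = 0 → ∃ m', m = x • m')
    (hx : ∀ k, ∀ m : M, x • m = 0 → ∃ N : ℕ, s k ^ N • m = 0) (ξ : LocalCoh s N j) :
    ∃ η, IsConnecting s hσ f x ξ η := by
  obtain ⟨c, hc, rfl⟩ := cechClass_surjective s ξ
  obtain ⟨b, rfl⟩ := cechCochainMap_surjective s hσ f hf j c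
  obtain ⟨w, hw⟩ := exists_smul_eq_of_cechCochainMap_eq_zero s hσ f hfx (j + 1) (cechDiff s M j b)
    (by rw [cechCochainMap_diff, hc])
  have hw' : cechDiff s M (j + 1) w = 0 :=
    cechCochain_smul_injective s hx _ _ (by rw [← map_smul, ← hw, cechDiff_comp])
  exact ⟨_, b, w, hc, hw', hw, rfl, rfl⟩

/-- If `w` is the coboundary of `v`, then `b - x • v` is a cocycle with the same image as `b`. -/
theorem IsConnecting.exists_eq {ξ : LocalCoh s N j} (h : IsConnecting s hσ f x ξ 0)
    (hfx : ∀ m, f (x • m) = 0) : ∃ ζ : LocalCoh s M j, localCohMap s hσ f j ζ = ξ := by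
  obtain ⟨b, w, hb, hw, hbw, rfl, hw0⟩ := h
  obtain ⟨v, rfl⟩ := (cechClass_eq_zero s).mp hw0
  have hxv : cechCochainMap s hσ f j (x • v) = 0 := by
    ext T
    simp only [cechCochainMap_apply, Pi.smul_apply, Pi.zero_apply]
    induction v T using LocalizedModule.induction_on with
    | _ m a => rw [LocalizedModule.smul'_mk, cechTermMap_mk, hfx, LocalizedModule.zero_mk]
  refine ⟨cechClass s M (b - x • v) (by rw [map_sub, map_smul, hbw, sub_self]), ?_⟩
  rw [localCohMap_cechClass]
  congr 1
  rw [map_sub, hxv, sub_zero]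

/-- This is well-definedness of the connecting map at zero: `b` can be corrected by a coboundary so
that it lies in the kernel of `f`, hence is `x • u`, and cancelling `x` in degree `j + 1` shows that
`w` is the coboundary of `u`. -/
theorem IsConnecting.eq_zero {η : LocalCoh s M (j + 1)} (h : IsConnecting s hσ f x 0 η)
    (hf : Function.Surjective f) (hfx : ∀ m, f m = 0 → ∃ m', m = x • m')
    (hx : ∀ k, ∀ m : M, x • m = 0 → ∃ N : ℕ, s k ^ N • m = 0) : η = 0 := by
  obtain ⟨b, w, hb, hw, hbw, hb0, rfl⟩ := h
  rw [cechClass_eq_zero] at hb0 ⊢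
  obtain ⟨b', hb', hdb'⟩ : ∃ b', cechCochainMap s hσ f j b' = 0 ∧
      cechDiff s M j b' = cechDiff s M j b := by
    cases j with
    | zero => exact ⟨b, hb0, rfl⟩
    | succ j =>
      obtain ⟨v, hv⟩ := hb0
      obtain ⟨v, rfl⟩ := cechCochainMap_surjective s hσ f hf j v
      refine ⟨b - cechDiff s M j v, ?_, ?_⟩
      · rw [map_sub, cechCochainMap_diff, hv, sub_self]
      · rw [map_sub, cechDiff_comp, sub_zero]
  obtain ⟨u, rfl⟩ := exists_smul_eq_of_cechCochainMap_eq_zero s hσ f hfx j b' hb'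
  refine ⟨u, sub_eq_zero.mp (cechCochain_smul_injective s hx j _ ?_)⟩
  rw [smul_sub, ← map_smul, hdb', hbw, sub_self]

/-- Applying a semilinear map to the equation `d b = x • w` turns `x` into `σ x`; for Frobenius, the
target sequence is the one for `x^{p^e}`. -/
theorem IsConnecting.map {σ : R →+* R} {M' N' : Type*} [AddCommGroup M'] [Module R M']
    [AddCommGroup N'] [Module R N'] {f' : M' →ₗ[R] N'} (hσ' : ∀ a, σ a ∈ Submonoid.powers a)
    {g : M →ₛₗ[σ] M'} {g' : N →ₛₗ[σ] N'} (hg : ∀ m, g' (f m) = f' (g m))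
    {ξ : LocalCoh s N j} {η : LocalCoh s M (j + 1)} (h : IsConnecting s hσ f x ξ η) :
    IsConnecting s hσ f' (σ x) (localCohMap s hσ' g' j ξ) (localCohMap s hσ' g (j + 1) η) := by
  obtain ⟨b, w, hb, hw, hbw, rfl, rfl⟩ := h
  have e : cechCochainMap s hσ f' j (cechCochainMap s hσ' g j b) =
      cechCochainMap s hσ' g' j (cechCochainMap s hσ f j b) := by
    rw [cechCochainMap_comp s hσ' hσ hσ' (fun _ => rfl) g f' (f'.comp g) fun _ => rfl]
    rw [cechCochainMap_comp s hσ hσ' hσ' (fun _ => rfl) f g' (f'.comp g) hg]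
  refine ⟨cechCochainMap s hσ' g j b, cechCochainMap s hσ' g (j + 1) w, ?_,
    cechCochainMap_diff_eq_zero s hσ' g hw, ?_, ?_, rfl⟩
  · rw [e]; exact cechCochainMap_diff_eq_zero s hσ' g' hb
  · rw [← cechCochainMap_diff, hbw, map_smulₛₗ]
  · rw [localCohMap_cechClass]
    congr 1

end Connecting

/-! ### Filter regular generators of parameter ideals -/

section FilterRegular

/-- Prime avoidance for cosets of an ideal. -/
theorem Ideal.exists_mem_forall_add_notMem {R : Type*} [CommRing R] (S : Finset (Ideal R))
    (hS : ∀ P ∈ S, P.IsPrime) (I : Ideal R) (x : R) (h : ∀ P ∈ S, x ∈ P → ¬ I ≤ P) :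
    ∃ a ∈ I, ∀ P ∈ S, x + a ∉ P := by
  classical
  -- The element `a` is chosen in `I` and in every prime of `S₂`, but outside those of `S₁`. Then `x
  -- + a` avoids `S₁` because of `a` and `S₂` because of `x`; any other prime of `S` lies inside a
  -- member of `S₁`.
  set S₁ := S.filter (x ∈ ·)
  set S₂ := S.filter fun Q => x ∉ Q ∧ ∀ P ∈ S₁, ¬ Q ≤ P
  have key : ¬ ((I ⊓ S₂.inf id : Ideal R) : Set R) ⊆ ⋃ P ∈ (S₁ : Set (Ideal R)), (P : Set R) := by
    intro hsub
    obtain ⟨P, hP, hle⟩ := (Ideal.subset_union_prime (f := id) ⊥ ⊥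
      (fun P hP _ _ => hS P (Finset.mem_filter.mp hP).1)).mp hsub
    have hP' := Finset.mem_filter.mp hP
    have := hS P hP'.1
    rcases (Ideal.IsPrime.inf_le this).mp hle with h1 | h1
    · exact h P hP'.1 hP'.2 h1
    · obtain ⟨Q, hQ, hQP⟩ := (Ideal.IsPrime.inf_le' this).mp h1
      exact (Finset.mem_filter.mp hQ).2.2 P hP hQP
  obtain ⟨a, ha, ha'⟩ := Set.not_subset.mp key
  simp only [Set.mem_iUnion, not_exists] at ha'
  have hP₁ : ∀ P ∈ S₁, x + a ∉ P := fun P hP hxa =>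
    ha' P hP ((Ideal.add_mem_iff_right _ (Finset.mem_filter.mp hP).2).mp hxa)
  refine ⟨a, ha.1, fun P hP hxa => ?_⟩
  by_cases hx : x ∈ P
  · exact hP₁ P (Finset.mem_filter.mpr ⟨hP, hx⟩) hxa
  by_cases hle : ∀ Q ∈ S₁, ¬ P ≤ Q
  · have : a ∈ P := (Finset.inf_le (f := id) (Finset.mem_filter.mpr ⟨hP, hx, hle⟩) :
      S₂.inf id ≤ P) ha.2
    exact hx ((Ideal.add_mem_iff_left _ this).mp hxa)
  · push Not at hle
    obtain ⟨Q, hQ, hPQ⟩ := hle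
    exact hP₁ Q hQ (hPQ hxa)

variable {R : Type*} [CommRing R]

theorem initialIdeal_succ {d : ℕ} (x : Fin d → R) (i : Fin d) :
    initialIdeal x (i + 1) = initialIdeal x i ⊔ Ideal.span {x i} := by
  rw [initialIdeal, initialIdeal, ← Ideal.span_union, ← Set.image_singleton, ← Set.image_union]
  congr 2
  ext k
  simp only [Set.mem_ofPred_eq, Set.mem_union, Set.mem_singleton_iff, Fin.ext_iff]
  omega

theorem initialIdeal_zero {d : ℕ} (x : Fin d → R) : initialIdeal x 0 = ⊥ := by
  simp [initialIdeal]

theorem initialIdeal_self {d : ℕ} (x : Fin d → R) :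
    initialIdeal x d = Ideal.span (Set.range x) := by
  simp [initialIdeal]

variable [IsLocalRing R]

/-- The terms are corrected one at a time, each by an element of the ideal `L` of the later terms,
which changes neither the total ideal nor the earlier terms. Avoidance applies because an associated
prime of the quotient by the earlier terms that contains the current term and `L` contains the whole
ideal, so it is `𝔪`. -/
theorem exists_isFilterRegular [IsNoetherianRing R] {d : ℕ} (x : Fin d → R)
    (hx : (Ideal.span (Set.range x)).radical = IsLocalRing.maximalIdeal R) :
    ∃ y : Fin d → R, Ideal.span (Set.range y) = Ideal.span (Set.range x) ∧ IsFilterRegular y := by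
  suffices h : ∀ i ≤ d, ∃ y : Fin d → R, Ideal.span (Set.range y) = Ideal.span (Set.range x) ∧
      ∀ k : Fin d, (k : ℕ) < i → ∀ P ∈ associatedPrimes R (R ⧸ initialIdeal y k),
        P ≠ IsLocalRing.maximalIdeal R → y k ∉ P by
    obtain ⟨y, hy, hy'⟩ := h d le_rfl
    refine ⟨y, hy, fun k => ⟨?_, hy' k k.2⟩⟩
    rw [← hx, ← hy]
    exact Ideal.le_radical (Ideal.subset_span ⟨k, rfl⟩)
  intro i
  induction i with
  | zero => exact fun _ => ⟨x, rfl, fun k hk => by omega⟩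
  | succ i ih =>
    intro hi
    obtain ⟨y, hy, hy'⟩ := ih (by omega)
    let i' : Fin d := ⟨i, hi⟩
    have hfin : (associatedPrimes R (R ⧸ initialIdeal y i)).Finite := associatedPrimes.finite R _
    classical
    set L := Ideal.span (y '' {k | i' < k})
    obtain ⟨a, ha, hav⟩ := Ideal.exists_mem_forall_add_notMem
      (hfin.toFinset.filter (· ≠ IsLocalRing.maximalIdeal R))
      (fun P hP => IsAssociatedPrime.isPrime
        (hfin.mem_toFinset.mp (Finset.mem_filter.mp hP).1))
      L (y i') (fun P hP hyP hLP => by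
        obtain ⟨hP, hne⟩ := Finset.mem_filter.mp hP
        rw [hfin.mem_toFinset] at hP
        have hPp : P.IsPrime := IsAssociatedPrime.isPrime hP
        have hJP : initialIdeal y i ≤ P := by
          have := IsAssociatedPrime.annihilator_le hP
          rwa [Submodule.annihilator_top, Ideal.annihilator_quotient] at this
        have hqP : Ideal.span (Set.range x) ≤ P := by
          rw [← hy, Ideal.span_le]
          rintro _ ⟨k, rfl⟩
          rcases lt_trichotomy k i' with hk | rfl | hk
          · exact hJP (Ideal.subset_span ⟨k, hk, rfl⟩)
          · exact hyP
          · exact hLP (Ideal.subset_span ⟨k, hk, rfl⟩)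
        refine hne (le_antisymm (IsLocalRing.le_maximalIdeal hPp.ne_top) ?_)
        rw [← hx]
        exact hPp.radical_le_iff.mpr hqP)
    set z := Function.update y i' (y i' + a)
    have hzi : z i' = y i' + a := Function.update_self ..
    have hz : ∀ k, k ≠ i' → z k = y k := fun k hk => Function.update_of_ne hk ..
    have hinit : ∀ k ≤ i, initialIdeal z k = initialIdeal y k := by
      intro k hk
      refine congrArg Ideal.span (Set.image_congr fun l hl => hz l fun e => ?_)
      subst e
      exact absurd hl (by simpa [i'] using hk)
    have hLz : L = Ideal.span (z '' {k | i' < k}) :=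
      congrArg Ideal.span (Set.image_congr fun l hl => (hz l (ne_of_gt hl)).symm)
    have hLz' : L ≤ Ideal.span (Set.range z) := hLz ▸ Ideal.span_mono (Set.image_subset_range _ _)
    have hLy' : L ≤ Ideal.span (Set.range y) := Ideal.span_mono (Set.image_subset_range _ _)
    refine ⟨z, hy ▸ le_antisymm ?_ ?_, ?_⟩
    · rw [Ideal.span_le]
      rintro _ ⟨k, rfl⟩
      by_cases hk : k = i'
      · rw [hk, hzi]
        exact Ideal.add_mem _ (Ideal.subset_span ⟨_, rfl⟩) (hLy' ha)
      · rw [hz k hk]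
        exact Ideal.subset_span ⟨_, rfl⟩
    · rw [Ideal.span_le]
      rintro _ ⟨k, rfl⟩
      by_cases hk : k = i'
      · rw [hk, ← add_sub_cancel_right (y i') a, ← hzi]
        exact Ideal.sub_mem _ (Ideal.subset_span ⟨_, rfl⟩) (hLz' ha)
      · rw [← hz k hk]
        exact Ideal.subset_span ⟨_, rfl⟩
    · intro k hk P hP hne
      rw [hinit k (by omega)] at hP
      by_cases hki : k = i'
      · subst hki
        rw [hzi]
        exact hav P (Finset.mem_filter.mpr ⟨hfin.mem_toFinset.mpr hP, hne⟩)
      · rw [hz k hki]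
        exact hy' k (lt_of_le_of_ne (by omega) fun e => hki (Fin.ext e)) P hP hne

/-- Otherwise, once the annihilators of `s ^ N • m` stabilize, `s` is a nonzerodivisor on the
nonzero module generated by `s ^ N • m`. An associated prime of that module contains `x` but not
`s`, so it is an associated prime of `M` other than `𝔪` that contains `x`. -/
theorem exists_pow_smul_eq_zero {M : Type*} [AddCommGroup M] [Module R M] [IsNoetherianRing R]
    {x s : R} (hs : s ∈ IsLocalRing.maximalIdeal R)
    (hx : ∀ P ∈ associatedPrimes R M, P ≠ IsLocalRing.maximalIdeal R → x ∉ P) (m : M)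
    (hm : x • m = 0) : ∃ N : ℕ, s ^ N • m = 0 := by
  by_contra! hN
  let A : ℕ →o Ideal R := ⟨fun N => (R ∙ (s ^ N • m)).annihilator, monotone_nat_of_le_succ
    fun N r hr => by
      rw [Submodule.mem_annihilator_span_singleton] at hr ⊢
      rw [pow_succ', mul_smul, smul_comm, hr, smul_zero]⟩
  obtain ⟨N, hA⟩ := monotone_stabilizes_iff_noetherian.mpr ‹IsNoetherianRing R› A
  have hstab : ∀ r : R, r • s • s ^ N • m = 0 → r • s ^ N • m = 0 := fun r hr => by
    have : r ∈ A N := by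
      rw [hA (N + 1) (Nat.le_succ N)]
      refine (Submodule.mem_annihilator_span_singleton _ _).mpr ?_
      rwa [pow_succ', mul_smul]
    exact (Submodule.mem_annihilator_span_singleton _ _).mp this
  let m₀ : R ∙ (s ^ N • m) := ⟨s ^ N • m, Submodule.mem_span_singleton_self _⟩
  have hm₀ : m₀ ≠ 0 := fun e => hN N (congrArg Subtype.val e)
  obtain ⟨P, hP, -⟩ := exists_le_isAssociatedPrime_of_isNoetherianRing R m₀ hm₀
  have hxP : x ∈ P := by
    refine hP.annihilator_le ?_
    rw [Submodule.annihilator_top]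
    change x ∈ (R ∙ (s ^ N • m)).annihilator
    rw [Submodule.mem_annihilator_span_singleton, smul_comm, hm, smul_zero]
  have hsP : s ∉ P := by
    intro hsP
    obtain ⟨hPp, y, hy⟩ := isAssociatedPrime_iff.mp hP
    obtain ⟨⟨_, hy'⟩, rfl⟩ : ∃ y', y' = y := ⟨y, rfl⟩
    obtain ⟨r, rfl⟩ := Submodule.mem_span_singleton.mp hy'
    rw [hy, Submodule.mem_colon_singleton, Submodule.mem_bot] at hsP
    have h0 : r • s • s ^ N • m = 0 := by
      rw [smul_comm]; exact congrArg Subtype.val hsP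
    refine hPp.ne_top ((Ideal.eq_top_iff_one _).mpr ?_)
    rw [hy, Submodule.mem_colon_singleton, one_smul, Submodule.mem_bot]
    exact Subtype.ext (hstab r h0)
  exact hx P (hP.map_of_injective _ (Submodule.subtype_injective _)) (fun e => hsP (e ▸ hs)) hxP

end FilterRegular

/-! ### Powers of filter regular sequences -/

section Powers

variable {R : Type*} [CommRing R]

/-- `y` is a nonzerodivisor modulo `I` up to `s`-power torsion. -/
def IsRegularModAway (s : R) (I : Ideal R) (y : R) : Prop :=
  ∀ a, y * a ∈ I → ∃ N : ℕ, s ^ N * a ∈ I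

variable {s : R} {I : Ideal R} {y z : R}

theorem IsRegularModAway.pow (h : IsRegularModAway s I y) (q : ℕ) :
    IsRegularModAway s I (y ^ q) := by
  induction q with
  | zero => exact fun a ha => ⟨0, by simpa using ha⟩
  | succ q ih =>
    intro a ha
    rw [pow_succ, mul_assoc] at ha
    obtain ⟨N, hN⟩ := ih _ ha
    obtain ⟨K, hK⟩ := h (s ^ N * a) (by rwa [mul_left_comm])
    exact ⟨K + N, by rwa [pow_add, mul_assoc]⟩

theorem mem_sup_span_singleton_iff {a : R} :
    a ∈ I ⊔ Ideal.span {y} ↔ ∃ b, a - y * b ∈ I := by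
  rw [Submodule.mem_sup]
  constructor
  · rintro ⟨i, hi, w, hw, rfl⟩
    obtain ⟨b, rfl⟩ := Ideal.mem_span_singleton'.mp hw
    exact ⟨b, by rwa [mul_comm y b, add_sub_cancel_right]⟩
  · rintro ⟨b, hb⟩
    exact ⟨_, hb, y * b, Ideal.mul_mem_right _ _ (Ideal.mem_span_singleton_self y), by ring⟩

/-- This allows `y` to be moved past `z` in a regular sequence. -/
theorem IsRegularModAway.sup (hy : IsRegularModAway s I y)
    (hz : IsRegularModAway s (I ⊔ Ideal.span {y}) z) :
    IsRegularModAway s (I ⊔ Ideal.span {z}) y := by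
  intro r hr
  obtain ⟨c, hc⟩ := mem_sup_span_singleton_iff.mp hr
  obtain ⟨N, hN⟩ := hz c (mem_sup_span_singleton_iff.mpr ⟨r, by simpa using I.neg_mem hc⟩)
  obtain ⟨c', hc'⟩ := mem_sup_span_singleton_iff.mp hN
  obtain ⟨K, hK⟩ := hy (s ^ N * r - z * c') (by
    have := I.add_mem (I.mul_mem_left (s ^ N) hc) (I.mul_mem_left z hc')
    convert this using 1
    ring)
  refine ⟨K + N, mem_sup_span_singleton_iff.mpr ⟨s ^ K * c', ?_⟩⟩
  convert hK using 1
  ring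

theorem IsRegularModAway.sup_pow (hy : IsRegularModAway s I y)
    (hz : IsRegularModAway s (I ⊔ Ideal.span {y}) z) (q : ℕ) :
    IsRegularModAway s (I ⊔ Ideal.span {y ^ q}) z := by
  induction q with
  | zero => exact fun a _ => ⟨0, by simp⟩
  | succ q ih =>
    intro r hr
    obtain ⟨b, hb⟩ := mem_sup_span_singleton_iff.mp hr
    obtain ⟨N, hN⟩ := ih r (mem_sup_span_singleton_iff.mpr ⟨y * b, by
      rwa [← mul_assoc, ← pow_succ]⟩)
    obtain ⟨b', hb'⟩ := mem_sup_span_singleton_iff.mp hN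
    obtain ⟨M, hM⟩ := hy.pow q (z * b' - s ^ N * y * b) (by
      have := I.sub_mem (I.mul_mem_left (s ^ N) hb) (I.mul_mem_left z hb')
      convert this using 1
      ring)
    obtain ⟨K, hK⟩ := hz (s ^ M * b') (mem_sup_span_singleton_iff.mpr ⟨s ^ M * s ^ N * b, by
      convert hM using 1
      ring⟩)
    obtain ⟨b'', hb''⟩ := mem_sup_span_singleton_iff.mp hK
    refine ⟨K + M + N, mem_sup_span_singleton_iff.mpr ⟨b'', ?_⟩⟩
    have := I.add_mem (I.mul_mem_left (s ^ (K + M)) hb') (I.mul_mem_left (y ^ q) hb'')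
    convert this using 1
    ring

theorem initialIdeal_succ' {d : ℕ} (x : Fin (d + 1) → R) (i : ℕ) :
    initialIdeal x (i + 1) = Ideal.span {x 0} ⊔ initialIdeal (fun k => x k.succ) i := by
  rw [initialIdeal, initialIdeal, ← Ideal.span_union]
  congr 1
  ext a
  simp [Fin.exists_fin_succ, eq_comm]

/-- Each term of the sequence is a nonzerodivisor modulo `I` and the preceding terms, up to `s`-power
torsion. -/
def IsRegularSeqAway (s : R) (I : Ideal R) {d : ℕ} (x : Fin d → R) : Prop :=
  ∀ i : Fin d, IsRegularModAway s (I ⊔ initialIdeal x i) (x i)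

theorem isRegularSeqAway_succ {d : ℕ} {x : Fin (d + 1) → R} :
    IsRegularSeqAway s I x ↔ IsRegularModAway s I (x 0) ∧
      IsRegularSeqAway s (I ⊔ Ideal.span {x 0}) (fun k => x k.succ) := by
  rw [IsRegularSeqAway, Fin.forall_fin_succ]
  simp only [Fin.val_zero, initialIdeal_zero, sup_bot_eq, Fin.val_succ, initialIdeal_succ',
    ← sup_assoc]
  rfl

/-- The first term of `x` is absorbed into `I`; by `IsRegularModAway.sup` the element `y` stays
regular modulo the larger ideal, so the induction continues. -/
theorem IsRegularSeqAway.sup_pow {d : ℕ} {x : Fin d → R} (hy : IsRegularModAway s I y)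
    (hx : IsRegularSeqAway s (I ⊔ Ideal.span {y}) x) (q : ℕ) :
    IsRegularSeqAway s (I ⊔ Ideal.span {y ^ q}) x := by
  induction d generalizing I with
  | zero => exact fun i => i.elim0
  | succ d ih =>
    rw [isRegularSeqAway_succ] at hx ⊢
    refine ⟨hy.sup_pow hx.1 q, ?_⟩
    rw [sup_right_comm]
    exact ih (hy.sup hx.1) (by rw [sup_right_comm]; exact hx.2)

theorem IsRegularSeqAway.pow {d : ℕ} {x : Fin d → R} (hx : IsRegularSeqAway s I x) (q : ℕ) :
    IsRegularSeqAway s I (fun k => x k ^ q) := by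
  induction d generalizing I with
  | zero => exact fun i => i.elim0
  | succ d ih =>
    rw [isRegularSeqAway_succ] at hx ⊢
    exact ⟨hx.1.pow q, ih (hx.2.sup_pow hx.1 q)⟩

theorem isRegularModAway_iff :
    IsRegularModAway s I y ↔ ∀ m : R ⧸ I, y • m = 0 → ∃ N : ℕ, s ^ N • m = 0 := by
  refine ⟨fun h m hm => ?_, fun h a ha => ?_⟩
  · obtain ⟨a, rfl⟩ := Submodule.Quotient.mk_surjective I m
    obtain ⟨N, hN⟩ := h a ((Submodule.Quotient.mk_eq_zero I).mp hm)
    exact ⟨N, (Submodule.Quotient.mk_eq_zero I).mpr hN⟩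
  · obtain ⟨N, hN⟩ := h (Submodule.Quotient.mk a) ((Submodule.Quotient.mk_eq_zero I).mpr ha)
    exact ⟨N, (Submodule.Quotient.mk_eq_zero I).mp hN⟩

theorem IsFilterRegular.isRegularSeqAway [IsLocalRing R] [IsNoetherianRing R] {d : ℕ}
    {x : Fin d → R} (hx : IsFilterRegular x) (hs : s ∈ IsLocalRing.maximalIdeal R) :
    IsRegularSeqAway s ⊥ x := by
  intro i
  rw [bot_sup_eq, isRegularModAway_iff]
  exact fun m hm => exists_pow_smul_eq_zero hs (hx i).2 m hm

end Powers

/-! ### Relative Frobenius and the induction step -/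

section RelativeFrobenius

variable {R : Type*} [CommRing R] (p : ℕ) [ExpChar R p]

theorem bracketPow_bracketPow (J : Ideal R) (a b : ℕ) :
    bracketPow p (bracketPow p J a) b = bracketPow p J (a + b) := by
  rw [bracketPow, bracketPow, bracketPow, Ideal.map_map]
  congr 1
  ext r
  simp [iterateFrobenius_def, pow_add, pow_mul]

theorem bracketPow_sup_span_singleton (J : Ideal R) (x : R) (e : ℕ) :
    bracketPow p (J ⊔ Ideal.span {x}) e = bracketPow p J e ⊔ Ideal.span {x ^ p ^ e} := by
  rw [bracketPow, bracketPow, Ideal.map_sup, Ideal.map_span, Set.image_singleton,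
    iterateFrobenius_def]

theorem bracketPow_initialIdeal {d : ℕ} (x : Fin d → R) (i e : ℕ) :
    bracketPow p (initialIdeal x i) e = initialIdeal (fun k => x k ^ p ^ e) i := by
  rw [bracketPow, initialIdeal, initialIdeal, Ideal.map_span, Set.image_image]
  rfl

variable {n : ℕ} (s : Fin n → R)

theorem bracketPow_mono {J K : Ideal R} (h : J ≤ K) (e : ℕ) : bracketPow p J e ≤ bracketPow p K e :=
  Ideal.map_mono h

/-- The map `R/J → R/K`, `x + J ↦ x^{p^e} + K`, where `J^{[p^e]} ⊆ K`. -/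
def frobeniusQuotient {J K : Ideal R} (e : ℕ) (h : bracketPow p J e ≤ K) :
    (R ⧸ J) →ₛₗ[iterateFrobenius R p e] (R ⧸ K) :=
  Submodule.mapQ J K (LinearMap.iterateFrobenius R R p e)
    (fun _ hx => h (Ideal.mem_map_of_mem (iterateFrobenius R p e) hx))

/-- The map `H^j(R/J) → H^j(R/K)` induced by `x + J ↦ x^{p^e} + K`, where `J^{[p^e]} ⊆ K`. -/
noncomputable def frobeniusQuotientCoh {J K : Ideal R} (e : ℕ) (h : bracketPow p J e ≤ K) (j : ℕ) :
    LocalCoh s (R ⧸ J) j →ₛₗ[iterateFrobenius R p e] LocalCoh s (R ⧸ K) j :=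
  localCohMap s (iterateFrobenius_mem_powers p e) (frobeniusQuotient p e h) j

theorem frobeniusQuotientCoh_comp {J K L : Ideal R} (a b : ℕ) (h : bracketPow p J a ≤ K)
    (h' : bracketPow p K b ≤ L) (h'' : bracketPow p J (a + b) ≤ L) (j : ℕ)
    (ξ : LocalCoh s (R ⧸ J) j) :
    frobeniusQuotientCoh p s b h' j (frobeniusQuotientCoh p s a h j ξ) =
      frobeniusQuotientCoh p s (a + b) h'' j ξ := by
  have hr : ∀ r : R, iterateFrobenius R p b (iterateFrobenius R p a r) =
      iterateFrobenius R p (a + b) r := fun r => by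
    simp [iterateFrobenius_def, pow_add, pow_mul]
  refine localCohMap_comp s _ _ _ hr (frobeniusQuotient p a h) (frobeniusQuotient p b h')
    (frobeniusQuotient p (a + b) h'') (fun m => ?_) j ξ
  obtain ⟨r, rfl⟩ := Submodule.Quotient.mk_surjective J m
  exact congrArg Submodule.Quotient.mk (hr r)

/-- Only vanishing is compared, since `(J^{[p^a]})^{[p^b]}` and `J^{[p^{a+b}]}` are equal ideals but
give different types. The variable target `L` in the proof absorbs this equality. -/
theorem relFrobeniusCoh_add_eq_zero (J : Ideal R) (a b j : ℕ) (ξ : LocalCoh s (R ⧸ J) j) :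
    relFrobeniusCoh p s (bracketPow p J a) b j (relFrobeniusCoh p s J a j ξ) = 0 ↔
      relFrobeniusCoh p s J (a + b) j ξ = 0 := by
  have h : ∀ L (hL : bracketPow p (bracketPow p J a) b = L),
      (relFrobeniusCoh p s (bracketPow p J a) b j (relFrobeniusCoh p s J a j ξ) = 0 ↔
        frobeniusQuotientCoh p s (J := J) (K := L) (a + b)
          (by rw [← hL, bracketPow_bracketPow]) j ξ = 0) := by
    rintro L rfl
    rw [← frobeniusQuotientCoh_comp p s a b le_rfl le_rfl]
    exact Iff.rfl
  exact h _ (bracketPow_bracketPow p J a b)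

theorem relFrobeniusCoh_mem_closureZero {J : Ideal R} {j : ℕ} {ξ : LocalCoh s (R ⧸ J) j}
    (hξ : ξ ∈ relFrobeniusClosureZero p s J j) (a : ℕ) :
    relFrobeniusCoh p s J a j ξ ∈ relFrobeniusClosureZero p s (bracketPow p J a) j := by
  obtain ⟨e, he⟩ := hξ
  refine ⟨e, (relFrobeniusCoh_add_eq_zero p s J a e j ξ).mpr ?_⟩
  rw [add_comm, ← relFrobeniusCoh_add_eq_zero, he, map_zero]

theorem relFrobeniusCoh_quotientCohMap {J K : Ideal R} (h : J ≤ K) (e j : ℕ)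
    (ξ : LocalCoh s (R ⧸ J) j) :
    relFrobeniusCoh p s K e j (quotientCohMap s h j ξ) =
      quotientCohMap s (bracketPow_mono p h e) j (relFrobeniusCoh p s J e j ξ) := by
  have hK := bracketPow_mono p h e
  have hid : ∀ r : R, RingHom.id R r ∈ Submonoid.powers r := fun r => Submonoid.mem_powers r
  let g : (R ⧸ J) →ₛₗ[iterateFrobenius R p e] (R ⧸ bracketPow p K e) := frobeniusQuotient p e hK
  let α : (R ⧸ J) →ₗ[R] (R ⧸ K) := Submodule.mapQ J K LinearMap.id h
  let β : (R ⧸ bracketPow p J e) →ₗ[R] (R ⧸ bracketPow p K e) := Submodule.mapQ _ _ LinearMap.id hK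
  have h₁ : ∀ m, relFrobenius p K e (α m) = g m := fun m => by
    obtain ⟨r, rfl⟩ := Submodule.Quotient.mk_surjective J m
    rfl
  have h₂ : ∀ m, β (relFrobenius p J e m) = g m := fun m => by
    obtain ⟨r, rfl⟩ := Submodule.Quotient.mk_surjective J m
    rfl
  have hF := iterateFrobenius_mem_powers (R := R) p e
  have e₁ := localCohMap_comp s hid hF hF (fun _ => rfl) α (relFrobenius p K e) g h₁ j ξ
  have e₂ := localCohMap_comp s hF hid hF (fun _ => rfl) (relFrobenius p J e) β g h₂ j ξ
  exact e₁.trans e₂.symm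

/-- If the relative Frobenius nilpotents of `H^{j+1}(R/J)` are killed by `F_R^a`, and those classes of
`H^j(R/J^{[p^a]})` that become nilpotent modulo `x^{p^a}` are killed by `F_R^b`, then the nilpotents of
`H^j(R/(J, x))` are killed by `F_R^{a+b}`. -/
theorem relFrobeniusCoh_eq_zero_of_sup {J J' : Ideal R} {x : R} (hJ' : J' = J ⊔ Ideal.span {x})
    (hx : ∀ k E, IsRegularModAway (s k) (bracketPow p J E) (x ^ p ^ E)) {j a b : ℕ}
    (ha : ∀ η ∈ relFrobeniusClosureZero p s J (j + 1), relFrobeniusCoh p s J a (j + 1) η = 0)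
    {K K' : Ideal R} (hK : K = bracketPow p J a) (hK' : K' = bracketPow p J' a) (hKK' : K ≤ K')
    (hb : ∀ ζ, quotientCohMap s hKK' j ζ ∈ relFrobeniusClosureZero p s K' j →
      relFrobeniusCoh p s K b j ζ = 0)
    {ξ : LocalCoh s (R ⧸ J') j} (hξ : ξ ∈ relFrobeniusClosureZero p s J' j) :
    relFrobeniusCoh p s J' (a + b) j ξ = 0 := by
  subst hK hK'
  have hle : J ≤ J' := hJ' ▸ le_sup_left
  let f (E : ℕ) : (R ⧸ bracketPow p J E) →ₗ[R] (R ⧸ bracketPow p J' E) :=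
    Submodule.mapQ _ _ LinearMap.id (bracketPow_mono p hle E)
  let f₀ : (R ⧸ J) →ₗ[R] (R ⧸ J') := Submodule.mapQ _ _ LinearMap.id hle
  have hsurj : ∀ {I I' : Ideal R} (h : I ≤ I'),
      Function.Surjective (Submodule.mapQ I I' LinearMap.id h) := fun h m => by
    obtain ⟨r, rfl⟩ := Submodule.Quotient.mk_surjective _ m
    exact ⟨Submodule.Quotient.mk r, rfl⟩
  have hker : ∀ {I I' : Ideal R} {y : R} (h : I ≤ I') (_ : I' = I ⊔ Ideal.span {y}) (m : R ⧸ I),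
      Submodule.mapQ I I' LinearMap.id h m = 0 → ∃ m', m = y • m' := fun {I I' y} h hI m hm => by
    obtain ⟨r, rfl⟩ := Submodule.Quotient.mk_surjective _ m
    have hr : r ∈ I' := (Submodule.Quotient.mk_eq_zero I').mp hm
    rw [hI, mem_sup_span_singleton_iff] at hr
    obtain ⟨b, hb⟩ := hr
    exact ⟨Submodule.Quotient.mk b, (Submodule.Quotient.eq I).mpr hb⟩
  have hJE : ∀ E, bracketPow p J' E = bracketPow p J E ⊔ Ideal.span {x ^ p ^ E} := fun E => by
    rw [hJ', bracketPow_sup_span_singleton]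
  have hreg₀ : ∀ k, ∀ m : R ⧸ J, x • m = 0 → ∃ N : ℕ, s k ^ N • m = 0 := fun k =>
    isRegularModAway_iff.mp (by simpa [bracketPow] using hx k 0)
  have hid : ∀ r : R, RingHom.id R r ∈ Submonoid.powers r := fun r => Submonoid.mem_powers r
  obtain ⟨η, hη⟩ := exists_isConnecting hid (f := f₀) (hsurj _) (hker _ hJ') hreg₀ ξ
  have hmap : ∀ E, IsConnecting s hid (f E) (x ^ p ^ E) (relFrobeniusCoh p s J' E j ξ)
      (relFrobeniusCoh p s J E (j + 1) η) := fun E => by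
    have := hη.map (f' := f E) (iterateFrobenius_mem_powers p E) (g := relFrobenius p J E)
      (g' := relFrobenius p J' E) (fun m => by
        obtain ⟨r, rfl⟩ := Submodule.Quotient.mk_surjective _ m
        rfl)
    rwa [iterateFrobenius_def] at this
  -- The exponent that kills `ξ` also kills `η`, by compatibility of the connecting map with
  -- Frobenius.
  have hηcl : η ∈ relFrobeniusClosureZero p s J (j + 1) := by
    obtain ⟨E, hE⟩ := hξ
    have := hmap E
    rw [hE] at this
    exact ⟨E, this.eq_zero (hsurj _) (hker _ (hJE E)) fun k => isRegularModAway_iff.mp (hx k E)⟩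
  have ha' := hmap a
  rw [ha η hηcl] at ha'
  -- Since `F_R^a ξ` has zero connecting image, it lifts to a class `ζ` modulo `J^{[p^a]}`.
  obtain ⟨ζ, hζ⟩ := ha'.exists_eq (fun m => by
    obtain ⟨r, rfl⟩ := Submodule.Quotient.mk_surjective _ m
    refine (Submodule.Quotient.mk_eq_zero _).mpr ?_
    rw [hJE]
    exact Ideal.mul_mem_right _ _ (Ideal.mem_sup_right (Ideal.mem_span_singleton_self _)))
  have hζ' : quotientCohMap s hKK' j ζ = relFrobeniusCoh p s J' a j ξ := hζ
  rw [← relFrobeniusCoh_add_eq_zero, ← hζ', relFrobeniusCoh_quotientCohMap, hb ζ, map_zero]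
  rw [hζ']
  exact relFrobeniusCoh_mem_closureZero p s hξ a

/-- The standard Frobenius action on `H^j(R)` agrees with the relative one on `H^j(R/0)`. -/
theorem relFrobeniusCoh_bot_eq_zero {J : Ideal R} (hJ : J = ⊥) {j h : ℕ}
    (hh : ∀ m, (∃ e, (frobeniusCoh p s j)^[e] m = 0) → (frobeniusCoh p s j)^[h] m = 0)
    {ξ : LocalCoh s (R ⧸ J) j} (hξ : ξ ∈ relFrobeniusClosureZero p s J j) :
    relFrobeniusCoh p s J h j ξ = 0 := by
  have hid : ∀ r : R, RingHom.id R r ∈ Submonoid.powers r := fun r => Submonoid.mem_powers r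
  -- `π` and `ι` are the mutually inverse isomorphisms between cohomology of `R` and of `R/0`, with
  -- a variable ideal so that they apply to `J` and to its bracket powers.
  let π (I : Ideal R) : LocalCoh s R j →ₗ[R] LocalCoh s (R ⧸ I) j :=
    localCohMap s hid (Submodule.mkQ I) j
  let ι (I : Ideal R) (hI : I = ⊥) : LocalCoh s (R ⧸ I) j →ₗ[R] LocalCoh s R j :=
    localCohMap s hid (Submodule.liftQ I LinearMap.id (by rw [hI]; exact bot_le)) j
  have hιπ : ∀ I hI m, ι I hI (π I m) = m := fun I hI m =>
    (localCohMap_comp s hid hid hid (fun _ => rfl) _ _ LinearMap.id (fun _ => rfl) j m).trans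
      (localCohMap_id s hid (fun _ => rfl) _ (fun _ => rfl) j m)
  have hπι : ∀ I hI m, π I (ι I hI m) = m := fun I hI m =>
    (localCohMap_comp s hid hid hid (fun _ => rfl) _ _ LinearMap.id (fun r => by
      obtain ⟨r, rfl⟩ := Submodule.Quotient.mk_surjective I r
      rfl) j m).trans
      (localCohMap_id s hid (fun _ => rfl) _ (fun _ => rfl) j m)
  have hiter : ∀ e m, (frobeniusCoh p s j)^[e] m = localCohMap s (iterateFrobenius_mem_powers p e)
      (LinearMap.iterateFrobenius R R p e) j m := fun e m => by
    induction e with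
    | zero =>
      exact (localCohMap_id s _ (fun r => by simp) _
        (fun r => by simp [LinearMap.iterateFrobenius_def]) j m).symm
    | succ e ih =>
      rw [Function.iterate_succ_apply', ih]
      refine localCohMap_comp s (iterateFrobenius_mem_powers p e)
        (fun a => ⟨p, (frobenius_def p a).symm⟩) (iterateFrobenius_mem_powers p (e + 1))
        (fun r => ?_) (LinearMap.iterateFrobenius R R p e) (LinearMap.frobenius R R p)
        (LinearMap.iterateFrobenius R R p (e + 1)) (fun r => ?_) j m
      · simp [iterateFrobenius_def, frobenius_def, pow_succ, pow_mul]
      · simp [LinearMap.iterateFrobenius_def, LinearMap.frobenius_def, pow_succ, pow_mul]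
  have hsq : ∀ e m, relFrobeniusCoh p s J e j (π J m) =
      π (bracketPow p J e) ((frobeniusCoh p s j)^[e] m) := fun e m => by
    rw [hiter]
    let g : R →ₛₗ[iterateFrobenius R p e] (R ⧸ bracketPow p J e) :=
      (Submodule.mkQ (bracketPow p J e)).comp (LinearMap.iterateFrobenius R R p e)
    have hF := iterateFrobenius_mem_powers (R := R) p e
    have e₁ := localCohMap_comp s hid hF hF (fun _ => rfl) (Submodule.mkQ J) (relFrobenius p J e) g
      (fun _ => rfl) j m
    have e₂ := localCohMap_comp s hF hid hF (fun _ => rfl) (LinearMap.iterateFrobenius R R p e)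
      (Submodule.mkQ (bracketPow p J e)) g (fun _ => rfl) j m
    exact e₁.trans e₂.symm
  obtain ⟨e, he⟩ := hξ
  have hJe : bracketPow p J e = ⊥ := by rw [hJ]; exact Ideal.map_bot
  rw [← hπι J hJ ξ, hsq] at he ⊢
  rw [hh _ ⟨e, ?_⟩, map_zero]
  rw [← hιπ _ hJe ((frobeniusCoh p s j)^[e] (ι J hJ ξ)), he, map_zero]

end RelativeFrobenius

/-! ### Binomial bound and the return to ideals -/

section TestExponent

variable {R : Type*} [CommRing R] (p : ℕ) [ExpChar R p]

theorem hslNumber_attained {M : Type*} [AddCommGroup M] [Module R M] (F : M →ₛₗ[frobenius R p] M)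
    (hF : hslNumber p F ≠ ⊤) : ∃ h : ℕ, hslNumber p F = h ∧
      ∀ m, (∃ e, F^[e] m = 0) → F^[h] m = 0 := by
  -- An infimum in `ℕ∞` is attained. If the attaining index failed the condition, its inner infimum
  -- would be empty and the value `⊤`.
  obtain ⟨h, hh⟩ := ciInf_mem fun e : ℕ =>
    ⨅ _ : ∀ m : M, (∃ e' : ℕ, F^[e'] m = 0) → F^[e] m = 0, (e : ℕ∞)
  change _ = hslNumber p F at hh
  by_cases hP : ∀ m : M, (∃ e' : ℕ, F^[e'] m = 0) → F^[h] m = 0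
  · exact ⟨h, by rw [← hh]; simp only [iInf_pos hP], hP⟩
  · exact absurd (by rw [← hh]; simp only [iInf_neg hP]) hF

/-- The iterated sums `E_{0,j} = h_j`, `E_{i+1,j} = E_{i,j+1} + E_{i,j}`. -/
def pascalSum (h : ℕ → ℕ) : ℕ → ℕ → ℕ
  | 0, j => h j
  | i + 1, j => pascalSum h i (j + 1) + pascalSum h i j

theorem pascalSum_eq (h : ℕ → ℕ) (i j : ℕ) :
    pascalSum h i j = ∑ k ∈ Finset.range (i + 1), i.choose k * h (j + k) := by
  induction i generalizing j with
  | zero => simp [pascalSum]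
  | succ i ih =>
    have h0 : ∑ k ∈ Finset.range (i + 1), i.choose (k + 1) * h (j + (k + 1)) + h j =
        ∑ k ∈ Finset.range (i + 1), i.choose k * h (j + k) := by
      have := Finset.sum_range_succ' (fun k => i.choose k * h (j + k)) (i + 1)
      rw [Finset.sum_range_succ] at this
      simpa using this.symm
    rw [pascalSum, ih, ih, Finset.sum_range_succ' _ (i + 1), ← h0]
    simp only [Nat.choose_succ_succ, add_mul, Finset.sum_add_distrib, Nat.choose_zero_right,
      one_mul, add_zero, add_assoc, add_comm 1]

variable {n : ℕ} (s : Fin n → R)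

/-- The exponent does not depend on `e`. This uniformity is essential: the step from `i` to `i + 1`
uses the bound for `i` at `e` and again at `e + pascalSum h i (j + 1)`. -/
theorem relFrobeniusCoh_eq_zero_of_isRegularSeqAway {d e₀ : ℕ} (x : Fin d → R)
    (hreg : ∀ k, IsRegularSeqAway (s k) ⊥ x)
    (hα : ∀ e, e₀ ≤ e → ∀ i j : ℕ, i + j < d →
      quotientCohMap s (bracketPow_initialIdeal_le_succ p x i e) j ⁻¹'
          relFrobeniusClosureZero p s (bracketPow p (initialIdeal x (i + 1)) e) j =
        relFrobeniusClosureZero p s (bracketPow p (initialIdeal x i) e) j)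
    (h : ℕ → ℕ) (hh : ∀ k ≤ d, ∀ m, (∃ e, (frobeniusCoh p s k)^[e] m = 0) →
      (frobeniusCoh p s k)^[h k] m = 0) (i j : ℕ) (hij : i + j ≤ d) (e : ℕ) (he : e₀ ≤ e) :
    ∀ ξ ∈ relFrobeniusClosureZero p s (bracketPow p (initialIdeal x i) e) j,
      relFrobeniusCoh p s _ (pascalSum h i j) j ξ = 0 := by
  induction i generalizing j e with
  | zero =>
    intro ξ hξ
    exact relFrobeniusCoh_bot_eq_zero p s (by rw [initialIdeal_zero]; exact Ideal.map_bot)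
      (hh j (by omega)) hξ
  | succ i ih =>
    intro ξ hξ
    let i' : Fin d := ⟨i, by omega⟩
    have hsucc : bracketPow p (initialIdeal x (i + 1)) e =
        bracketPow p (initialIdeal x i) e ⊔ Ideal.span {x i' ^ p ^ e} := by
      rw [← bracketPow_sup_span_singleton, ← initialIdeal_succ x i']
    refine relFrobeniusCoh_eq_zero_of_sup p s hsucc (fun k E => ?_) (ih (j + 1) (by omega) e he)
      (bracketPow_bracketPow p _ _ _).symm (bracketPow_bracketPow p _ _ _).symm
      (bracketPow_initialIdeal_le_succ p x i _) (fun ζ hζ => ?_) hξ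
    -- The terms are already raised to the power `p ^ e`, and regularity is needed after a further
    -- `p ^ E`.
    · have := (hreg k).pow (p ^ (e + E)) i'
      rw [bot_sup_eq, ← bracketPow_initialIdeal, ← bracketPow_bracketPow] at this
      rwa [← pow_mul, ← pow_add]
    · have he' : e₀ ≤ e + pascalSum h i (j + 1) := by omega
      refine ih j (by omega) _ he' ζ ?_
      rw [← hα _ he' i j (by omega)]
      exact hζ

/-- If `J` contains a power of each `s_k`, then every element of `R/J` is a `0`-cocycle. -/
theorem cechDiff_zero_eq_zero {J : Ideal R} (hJ : ∀ k, ∃ N : ℕ, s k ^ N ∈ J) (r : R ⧸ J) :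
    cechDiff s (R ⧸ J) 0 (fun _ => LocalizedModule.mk r 1) = 0 := by
  ext T
  obtain ⟨k, hk⟩ : T.1.Nonempty := Finset.card_pos.mp (by rw [T.2]; omega)
  have hsub : Subsingleton (CechTerm s (R ⧸ J) T.1) := by
    obtain ⟨N, hN⟩ := hJ k
    refine subsingleton_of_forall_eq 0 fun z => ?_
    induction z using LocalizedModule.induction_on with
    | _ m a =>
      rw [← LocalizedModule.zero_mk 1, LocalizedModule.mk_eq]
      refine ⟨⟨(∏ i ∈ T.1, s i) ^ N, pow_mem (Submonoid.mem_powers _) N⟩, ?_⟩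
      simp only [one_smul, smul_zero]
      obtain ⟨r, rfl⟩ := Submodule.Quotient.mk_surjective J m
      refine (Submodule.Quotient.mk_eq_zero J).mpr ?_
      change (∏ i ∈ T.1, s i) ^ N * r ∈ J
      rw [show (∏ i ∈ T.1, s i) ^ N = (∏ i ∈ T.1.erase k, s i) ^ N * s k ^ N by
        rw [← mul_pow, Finset.prod_erase_mul _ _ hk]]
      exact J.mul_mem_right _ (J.mul_mem_left _ hN)
  exact Subsingleton.elim _ _

theorem pow_mem_bracketPow {J : Ideal R} {r : R} (hr : r ∈ J) (e : ℕ) :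
    r ^ p ^ e ∈ bracketPow p J e :=
  Ideal.mem_map_of_mem (iterateFrobenius R p e) hr

/-- If `F_R^E` kills the relative Frobenius closure of zero in `H^0(R/J)`, where `J` is primary to the
ideal generated by the `s_k`, then `r^{p^E} ∈ J^{[p^E]}` for `r` in the Frobenius closure of `J`. -/
theorem pow_mem_bracketPow_of_relFrobeniusCoh_eq_zero {J : Ideal R}
    (hJ : ∀ k, ∃ N : ℕ, s k ^ N ∈ J) {E : ℕ}
    (hE : ∀ ξ ∈ relFrobeniusClosureZero p s J 0, relFrobeniusCoh p s J E 0 ξ = 0)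
    {r : R} {e : ℕ} (hr : r ^ p ^ e ∈ bracketPow p J e) : r ^ p ^ E ∈ bracketPow p J E := by
  let ξ : LocalCoh s (R ⧸ J) 0 :=
    cechClass s (R ⧸ J) _ (cechDiff_zero_eq_zero s hJ (Submodule.Quotient.mk r))
  have key : ∀ e, relFrobeniusCoh p s J e 0 ξ = 0 ↔ r ^ p ^ e ∈ bracketPow p J e := by
    intro e
    let c : CechCochain s (R ⧸ J) 0 := fun _ => LocalizedModule.mk (Submodule.Quotient.mk r) 1
    have hc : relFrobeniusCoh p s J e 0 ξ = 0 ↔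
        -- There are no coboundaries in degree `0`, so a class vanishes only if its cochain does.
        cechCochainMap s (iterateFrobenius_mem_powers p e) (relFrobenius p J e) 0 c = 0 :=
      cechClass_eq_zero s
    rw [hc, ← Submodule.Quotient.mk_eq_zero]
    have hmap : ∀ T, cechCochainMap s (iterateFrobenius_mem_powers p e) (relFrobenius p J e) 0 c T =
        LocalizedModule.mk (Submodule.Quotient.mk (r ^ p ^ e)) 1 := by
      intro T
      rw [cechCochainMap_apply, cechTermMap_mk]
      congr 1
      exact Subtype.ext (map_one (iterateFrobenius R p e))
    constructor
    · intro h0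
      -- The component at `∅` is the localization at powers of the empty product `1`, so nothing is
      -- lost.
      have := hmap ⟨∅, rfl⟩
      rw [h0, Pi.zero_apply, ← LocalizedModule.zero_mk 1, LocalizedModule.mk_eq] at this
      obtain ⟨⟨u, k, hk⟩, hu⟩ := this
      obtain rfl : u = 1 := by simpa using hk.symm
      rw [one_smul, one_smul, smul_zero] at hu
      exact (one_smul R _).symm.trans hu.symm
    · intro h0
      funext T
      rw [hmap, h0, LocalizedModule.zero_mk, Pi.zero_apply]
  exact (key E).mp (hE ξ ⟨e, (key e).mpr hr⟩)

end TestExponent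

/-! ### The bound on the Frobenius test exponent -/

theorem mainTheorem1 {R : Type*} [CommRing R] [IsLocalRing R] [IsNoetherianRing R]
    (p : ℕ) [Fact p.Prime] [CharP R p]
    (d : ℕ) (hd : ringKrullDim R = d)
    {n : ℕ} (s : Fin n → R) (hs : Ideal.span (Set.range s) = IsLocalRing.maximalIdeal R)
    (e₀ : ℕ)
    (hα : ∀ e : ℕ, e₀ ≤ e → ∀ x : Fin d → R, IsSystemOfParameters x → IsFilterRegular x →
      ∀ i j : ℕ, i + j < d →
        quotientCohMap s (bracketPow_initialIdeal_le_succ p x i e) j ⁻¹'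
            relFrobeniusClosureZero p s (bracketPow p (initialIdeal x (i + 1)) e) j =
          relFrobeniusClosureZero p s (bracketPow p (initialIdeal x i) e) j) :
    frobeniusTestExponent R p ≤
      e₀ + ∑ k ∈ Finset.range (d + 1), (d.choose k : ℕ∞) * hslNumber p (frobeniusCoh p s k) := by

  by_cases hfin : ∀ k ≤ d, hslNumber p (frobeniusCoh p s k) ≠ ⊤
  swap
  · push Not at hfin
    obtain ⟨k, hk, hk'⟩ := hfin
    have hle : (d.choose k : ℕ∞) * hslNumber p (frobeniusCoh p s k) ≤
        ∑ k ∈ Finset.range (d + 1), (d.choose k : ℕ∞) * hslNumber p (frobeniusCoh p s k) :=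
      Finset.single_le_sum (f := fun k => (d.choose k : ℕ∞) * hslNumber p (frobeniusCoh p s k))
        (fun _ _ => zero_le) (Finset.mem_range.mpr (by omega))
    -- The binomial coefficient is nonzero for `k ≤ d`, so an infinite HSL number makes the
    -- right-hand side infinite.
    rw [hk', ENat.mul_top (by exact_mod_cast (Nat.choose_pos hk).ne'), top_le_iff] at hle
    rw [hle, add_top]
    exact le_top
  choose! h hh hh' using fun k hk => hslNumber_attained p (frobeniusCoh p s k) (hfin k hk)
  have hsum : (e₀ : ℕ∞) + ∑ k ∈ Finset.range (d + 1),
      (d.choose k : ℕ∞) * hslNumber p (frobeniusCoh p s k) = (e₀ + pascalSum h d 0 : ℕ) := by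
    rw [pascalSum_eq]
    push_cast
    congr 1
    refine Finset.sum_congr rfl fun k hk => ?_
    rw [hh k (by have := Finset.mem_range.mp hk; omega), zero_add]
  rw [hsum]
  refine iInf₂_le _ ?_
  rintro q ⟨d', x', ⟨hd', hx'⟩, rfl⟩
  obtain rfl : d' = d := by exact_mod_cast hd'.symm.trans hd
  obtain ⟨x, hxx', hx⟩ := exists_isFilterRegular x' hx'
  rw [← hxx'] at hx' ⊢
  set q := Ideal.span (Set.range x)
  have hsm : ∀ k, s k ∈ IsLocalRing.maximalIdeal R := fun k => hs ▸ Ideal.subset_span ⟨k, rfl⟩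
  have hkill := relFrobeniusCoh_eq_zero_of_isRegularSeqAway p s x
    (fun k => hx.isRegularSeqAway (hsm k)) (fun e he => hα e he x ⟨hd', hx'⟩ hx) h hh'
    d' 0 le_rfl e₀ le_rfl
  rw [initialIdeal_self] at hkill
  have hprim : ∀ k, ∃ N : ℕ, s k ^ N ∈ bracketPow p q e₀ := fun k => by
    obtain ⟨N, hN⟩ : s k ∈ q.radical := hx' ▸ hsm k
    exact ⟨N * p ^ e₀, by rw [pow_mul]; exact pow_mem_bracketPow p hN e₀⟩
  refine le_antisymm ?_ (bracketPow_mono p (fun r hr => ?_) _)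
  · refine Ideal.map_le_iff_le_comap.mpr fun r hr => ?_
    obtain ⟨e, he⟩ := Filter.eventually_atTop.mp hr
    -- Evaluating at `e₀ + e` shows that `r ^ p ^ e₀` represents a nilpotent class modulo
    -- `q^{[p^e₀]}`, to which `hkill` applies.
    have hre := he (e₀ + e) (by omega)
    rw [pow_add, pow_mul, ← bracketPow_bracketPow] at hre
    rw [Ideal.mem_comap, iterateFrobenius_def, pow_add, pow_mul, ← bracketPow_bracketPow]
    exact pow_mem_bracketPow_of_relFrobeniusCoh_eq_zero p s hprim hkill hre
  · exact Filter.Eventually.of_forall fun e => pow_mem_bracketPow p hr e
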